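/- Let $\alpha>-1/2$ and let $n\ge 0$ be an integer. Let $G_k^{(\alpha)}$ denote the Gegenbauer polynomials, generated by $G_0^{(\alpha)}=1$, $G_1^{(\alpha)}(x)=x$ and $(j+2\alpha)G_{j+1}^{(\alpha)}(x)=2(j+\alpha)\,x\,G_j^{(\alpha)}(x)-j\,G_{j-1}^{(\alpha)}(x)$ for $j\ge1$; they are orthogonal on $[-1,1]$ with respect to the weight $w^{(\alpha)}(x)=(1-x^2)^{\alpha-1/2}$. Then $G_{n+1}^{(\alpha)}$ has exactly $n+1$ distinct real zeros (the Gegenbauer–Gauss points). List them, in increasing or in decreasing order, as $x_0,\dots,x_n$, and let $$\ell_i(x)=\prod_{j\ne i}\frac{x-x_j}{x_i-x_j},\qquad \varpi_i=\int_{-1}^{1}\ell_i(x)\,w^{(\alpha)}(x)\,dx,\qquad \xi_i=\frac{1}{\prod_{j\ne i}(x_i-x_j)},\qquad i=0,\dots,n,$$ be the Lagrange basis polynomials, the Christoffel numbers and the barycentric weights. Put $$\hat\xi_i=(-1)^i\,\sin(\arccos x_i)\,\sqrt{\varpi_i},\qquad i=0,\dots,n.$$ Then the following hold. 1. The $\hat\xi_i$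 are the barycentric weights up to a common factor: there is a real constant $c\neq0$ with $\xi_i=c\,\hat\xi_i$ for all $i=0,\dots,n$. 2. Consequently the $\hat\xi_i$ may be used in the barycentric formula: for every $i$ and every real $x\notin\{x_0,\dots,x_n\}$, $$\frac{\hat\xi_i/(x-x_i)}{\sum_{j=0}^n \hat\xi_j/(x-x_j)}=\ell_i(x).$$ 3. The $\hat\xi_i$ coincide with the algebraic form of the weights: $\hat\xi_i=(-1)^i\sqrt{(1-x_i^2)\,\varpi_i}$ for all $i$. -/

import Mathlib

open Polynomial

noncomputable section

/-- The Gegenbauer polynomials `G_n^{(α)}`, `α > -1/2`, generated by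
`G_0 = 1`, `G_1 = X`, `(j + 2α) G_{j+1} = 2 (j + α) X G_j - j G_{j-1}` for `j ≥ 1`.
This is the symmetric Jacobi polynomial with parameters `α - 1/2`, standardized by the value `1`
at the point `1`, so that `α = 0` (Chebyshev polynomials of the first kind) is not degenerate. -/
def gegenbauer (α : ℝ) : ℕ → ℝ[X]
  | 0 => 1
  | 1 => X
  | (j + 2) =>
      C ((j + 1 : ℝ) + 2 * α)⁻¹ *
        (C (2 * ((j + 1 : ℝ) + α)) * X * gegenbauer α (j + 1) - C (j + 1 : ℝ) * gegenbauer α j)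

/-- The Gegenbauer weight function `(1 - x²)^(α - 1/2)`. -/
def gegenbauerWeight (α x : ℝ) : ℝ := (1 - x ^ 2) ^ (α - 1 / 2)

/-- The `i`-th Gegenbauer-Gauss node, `i = 0, …, n`: the `i`-th smallest zero of
`G_{n+1}^{(α)}`.  (The default value `0` is never used when `α > -1/2`.) -/
def gaussNode (α : ℝ) (n : ℕ) (i : Fin (n + 1)) : ℝ :=
  ((gegenbauer α (n + 1)).roots.toFinset.sort (· ≤ ·)).getD i 0

/-- The Christoffel numbers of the nodes `x 0, …, x n`, that is, the weights of the
interpolatory quadrature at these nodes for the Gegenbauer weight: the integral of the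
`i`-th Lagrange basis polynomial against the weight function. -/
def christoffelNumber (α : ℝ) {n : ℕ} (x : Fin (n + 1) → ℝ) (i : Fin (n + 1)) : ℝ :=
  ∫ t in (-1 : ℝ)..1, (Lagrange.basis Finset.univ x i).eval t * gegenbauerWeight α t

/-- The exact barycentric weights `1 / ∏_{j ≠ i} (x i - x j)`. -/
def barycentricWeight {n : ℕ} (x : Fin (n + 1) → ℝ) (i : Fin (n + 1)) : ℝ :=
  1 / ∏ j ∈ Finset.univ.erase i, (x i - x j)

/-- The barycentric formula with weights `ξ` at the nodes `x`:
`(ξ i / (t - x i)) / ∑ j, ξ j / (t - x j)`. -/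
def barycentricBasis {n : ℕ} (x ξ : Fin (n + 1) → ℝ) (i : Fin (n + 1)) (t : ℝ) : ℝ :=
  (ξ i / (t - x i)) / ∑ j, ξ j / (t - x j)

/-- The trigonometric weights `(-1)^i sin (arccos (x i)) √(ϖ i)`. -/
def trigWeight (α : ℝ) {n : ℕ} (x : Fin (n + 1) → ℝ) (i : Fin (n + 1)) : ℝ :=
  (-1) ^ (i : ℕ) * Real.sin (Real.arccos (x i)) * √(christoffelNumber α x i)

end

/-! Write `D i` for the product of `x i - x j` over `j ≠ i`, and `L` for integration against the
weight. Everything rests on `(1 - x i ^ 2) * ϖ i * D i ^ 2` being a positive constant `K'`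
independent of `i` (`exists_christoffelNumber_mul_eq`). Square roots then give `1 / |D i| = √((1 - x
i ^ 2) ϖ i) / √K'`, and the sign of `D i` alternates because the nodes are ordered.

The constant comes from two identities at a zero `y` of `G_{n+1}`: the structure relation `(1 - y²)
G'_{n+1}(y) = (n + 1) G_n(y)`, and the Casoratian `L(G_{n+1} / (X - y)) * G_n(y) = K`
(`exists_casoratian_eq`). With leading coefficient `a`, `G'_{n+1}(x i) = a D i` and `L(G_{n+1} / (X
- x i)) = a D i ϖ i`, so eliminating `G_n` yields `K' = (n + 1) K / a²`.

Orthogonality follows from integration by parts, and it forces all zeros to be real and inside `(-1,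
1)`; the Casoratian makes them simple. -/

/-! ### Algebra of the recurrence: degree and structure relation. -/

theorem gegenbauer_recurrence {α : ℝ} (hα : -1 / 2 < α) (m : ℕ) :
    C ((m + 1 : ℝ) + 2 * α) * gegenbauer α (m + 2) =
      C (2 * ((m + 1 : ℝ) + α)) * X * gegenbauer α (m + 1) - C (m + 1 : ℝ) * gegenbauer α m := by
  have h : ((m + 1 : ℝ) + 2 * α) ≠ 0 := by
    have : (0 : ℝ) ≤ m := m.cast_nonneg
    linarith
  rw [gegenbauer, ← mul_assoc, ← C_mul, mul_inv_cancel₀ h, C_1, one_mul]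

theorem gegenbauer_natDegree_le_and_coeff_pos {α : ℝ} (hα : -1 / 2 < α) (m : ℕ) :
    (gegenbauer α m).natDegree ≤ m ∧ 0 < (gegenbauer α m).coeff m := by
  induction m using Nat.twoStepInduction with
  | zero => simp [gegenbauer]
  | one => simp [gegenbauer]
  | more m ih₀ ih₁ =>
    have hm : (0 : ℝ) ≤ m := m.cast_nonneg
    constructor
    · rw [gegenbauer]
      refine (natDegree_C_mul_le _ _).trans ((natDegree_sub_le_of_le (m := m + 2) (n := m + 2) ?_ ?_).trans (max_self _).le)
      · rw [mul_assoc]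
        refine (natDegree_C_mul_le _ _).trans (natDegree_mul_le.trans ?_)
        rw [natDegree_X]
        omega
      · exact (natDegree_C_mul_le _ _).trans (by omega)
    · have h₀ : (gegenbauer α m).coeff (m + 2) = 0 :=
        coeff_eq_zero_of_natDegree_lt (by omega)
      rw [gegenbauer, coeff_C_mul, coeff_sub, coeff_C_mul, h₀, mul_assoc, coeff_C_mul,
        coeff_X_mul, mul_zero, sub_zero]
      have := ih₁.2
      have : 0 < (m + 1 : ℝ) + 2 * α := by linarith
      have : 0 < (m + 1 : ℝ) + α := by linarith
      positivity

theorem gegenbauer_ne_zero {α : ℝ} (hα : -1 / 2 < α) (m : ℕ) : gegenbauer α m ≠ 0 := by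
  intro h
  simpa [h] using (gegenbauer_natDegree_le_and_coeff_pos hα m).2

theorem natDegree_gegenbauer {α : ℝ} (hα : -1 / 2 < α) (m : ℕ) :
    (gegenbauer α m).natDegree = m :=
  natDegree_eq_of_le_of_coeff_ne_zero (gegenbauer_natDegree_le_and_coeff_pos hα m).1
    (gegenbauer_natDegree_le_and_coeff_pos hα m).2.ne'

/-- Differentiate the recurrence, multiply by `1 - X ^ 2`, replace the lower derivatives by the two
previous instances, and simplify with two consecutive recurrences. There is no instance for `G_0`,
so `G_2` is a separate base case. -/
theorem one_sub_sq_mul_derivative_gegenbauer {α : ℝ} (hα : -1 / 2 < α) (m : ℕ) :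
    (1 - X ^ 2) * derivative (gegenbauer α (m + 1)) =
      C (m + 1 : ℝ) * (gegenbauer α m - X * gegenbauer α (m + 1)) := by
  induction m using Nat.strong_induction_on with
  | _ m ih =>
  match m with
  | 0 =>
    simp [gegenbauer]
    ring
  | 1 =>
    have h : (C ((0 + 1 : ℝ) + 2 * α) : ℝ[X]) ≠ 0 := by
      rw [Ne, C_eq_zero]
      linarith
    have r := gegenbauer_recurrence hα 0
    have d := congrArg derivative r
    simp only [gegenbauer.eq_1, gegenbauer.eq_2, Nat.cast_zero, zero_add] at r d h ⊢
    apply mul_left_cancel₀ h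
    simp only [derivative_mul, derivative_sub, derivative_C, derivative_X,
      zero_mul, zero_add, mul_one, sub_zero] at d
    simp only [C_add, C_mul, C_1, Nat.cast_one, map_ofNat] at r d ⊢
    linear_combination (1 - X ^ 2) * d + 2 * X * r
  | m + 2 =>
    have h : (C (((m + 1 : ℕ) + 1 : ℝ) + 2 * α) : ℝ[X]) ≠ 0 := by
      rw [Ne, C_eq_zero]
      have : (0 : ℝ) ≤ m := m.cast_nonneg
      push_cast
      linarith
    have r₁ := gegenbauer_recurrence hα m
    have r := gegenbauer_recurrence hα (m + 1)
    have d := congrArg derivative r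
    have i₀ := ih m (by omega)
    have i₁ := ih (m + 1) (by omega)
    apply mul_left_cancel₀ h
    simp only [derivative_mul, derivative_sub, derivative_C, derivative_X,
      zero_mul, zero_add, mul_one] at d
    simp only [C_add, C_mul, C_1, Nat.cast_add, Nat.cast_one, Nat.cast_ofNat, map_ofNat]
      at r r₁ d i₀ i₁ ⊢
    generalize gegenbauer α m = P₀ at *
    generalize gegenbauer α (m + 1) = P₁ at *
    generalize gegenbauer α (m + 1 + 1) = P₂ at *
    generalize gegenbauer α (m + 2 + 1) = P₃ at *
    generalize (C α : ℝ[X]) = a at *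
    generalize (C (m : ℝ) : ℝ[X]) = k at *
    linear_combination (1 - X ^ 2) * d + 2 * (k + 2 + a) * X * i₁ - (k + 2) * i₀
      + (k + 3) * X * r - (k + 2) * r₁

/-! ### Orthogonality and zeros, for a functional satisfying Pearson's identity. -/

section Functional

variable {α : ℝ} {L : ℝ[X] →ₗ[ℝ] ℝ}

theorem functional_C_mul (c : ℝ) (p : ℝ[X]) : L (C c * p) = c * L p := by
  rw [← smul_eq_C_mul, map_smul, smul_eq_mul]

/-- Pearson's identity at `F = G_{m+2}`, rewritten by the structure relation, turns `L G_{m+1} = 0`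
into `L (X G_{m+2}) = 0`; the recurrence then gives `L G_{m+3} = 0`. -/
theorem functional_gegenbauer_eq_zero (hα : -1 / 2 < α)
    (hL : ∀ F : ℝ[X], L ((1 - X ^ 2) * derivative F - C (2 * α + 1) * (X * F)) = 0) (m : ℕ) :
    L (gegenbauer α (m + 1)) = 0 := by
  induction m using Nat.twoStepInduction with
  | zero =>
    have h := hL 1
    simp only [derivative_one, mul_zero, mul_one, zero_sub, map_neg, functional_C_mul,
      neg_eq_zero, mul_eq_zero] at h
    rcases h with h | h
    · linarith
    · simpa [gegenbauer] using h
  | one =>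
    have h := hL X
    have r := congrArg L (gegenbauer_recurrence hα 0)
    have e : (1 - X ^ 2) * derivative X - C (2 * α + 1) * (X * X) =
        (1 : ℝ[X]) - C (2 * α + 2) * (X * X) := by
      simp only [derivative_X, C_add, C_mul, map_ofNat, C_1]
      ring
    rw [e, map_sub, functional_C_mul] at h
    rw [map_sub, mul_assoc, functional_C_mul, functional_C_mul, functional_C_mul] at r
    simp only [gegenbauer.eq_1, gegenbauer.eq_2, Nat.cast_zero, zero_add] at r
    have : (1 + 2 * α) * L (gegenbauer α 2) = 0 := by linear_combination r - h
    rcases mul_eq_zero.1 this with h | h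
    · linarith
    · exact h
  | more m ih _ =>
    have hm : (0 : ℝ) ≤ m := m.cast_nonneg
    have h := hL (gegenbauer α (m + 2))
    have r := congrArg L (gegenbauer_recurrence hα (m + 1))
    rw [one_sub_sq_mul_derivative_gegenbauer hα (m + 1), map_sub, functional_C_mul,
      functional_C_mul, map_sub, ih] at h
    rw [map_sub, mul_assoc, functional_C_mul, functional_C_mul, functional_C_mul, ih] at r
    push_cast at h r
    have h0 : (m + 1 + 1 + (2 * α + 1)) * L (X * gegenbauer α (m + 1 + 1)) = 0 := by
      linear_combination -h
    have h1 : L (X * gegenbauer α (m + 1 + 1)) = 0 := by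
      rcases mul_eq_zero.1 h0 with h | h
      · linarith
      · exact h
    rw [h1] at r
    have h2 : (m + 1 + 1 + 2 * α) * L (gegenbauer α (m + 1 + 2)) = 0 := by
      linear_combination r
    rcases mul_eq_zero.1 h2 with h | h
    · linarith
    · exact h

theorem functional_X_pow_mul_gegenbauer_eq_zero (hα : -1 / 2 < α)
    (hL : ∀ F : ℝ[X], L ((1 - X ^ 2) * derivative F - C (2 * α + 1) * (X * F)) = 0)
    (j m : ℕ) (hj : j < m) : L (X ^ j * gegenbauer α m) = 0 := by
  induction j generalizing m with
  | zero =>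
    obtain ⟨m, rfl⟩ := Nat.exists_eq_succ_of_ne_zero hj.ne'
    simpa using functional_gegenbauer_eq_zero hα hL m
  | succ j ih =>
    obtain ⟨m, rfl⟩ := Nat.exists_eq_succ_of_ne_zero (Nat.ne_zero_of_lt hj)
    have hm : (0 : ℝ) ≤ m := m.cast_nonneg
    have r := congrArg (fun p => L (X ^ j * p)) (gegenbauer_recurrence hα m)
    have e : X ^ j * (C (2 * ((m + 1 : ℝ) + α)) * X * gegenbauer α (m + 1)
        - C (m + 1 : ℝ) * gegenbauer α m) = C (2 * ((m + 1 : ℝ) + α)) *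
        (X ^ (j + 1) * gegenbauer α (m + 1)) - C (m + 1 : ℝ) * (X ^ j * gegenbauer α m) := by
      ring
    simp only [e, mul_left_comm (X ^ j) (C _), map_sub, functional_C_mul,
      ih m (by omega), ih (m + 2) (by omega)] at r
    have h : (2 * ((m + 1 : ℝ) + α)) * L (X ^ (j + 1) * gegenbauer α (m + 1)) = 0 := by
      linear_combination -r
    rcases mul_eq_zero.1 h with h | h
    · linarith
    · exact h

theorem functional_gegenbauer_mul_eq_zero (hα : -1 / 2 < α)
    (hL : ∀ F : ℝ[X], L ((1 - X ^ 2) * derivative F - C (2 * α + 1) * (X * F)) = 0)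
    (m : ℕ) (p : ℝ[X]) (hp : p.natDegree < m) : L (gegenbauer α m * p) = 0 := by
  rw [p.as_sum_range_C_mul_X_pow, Finset.mul_sum, map_sum]
  refine Finset.sum_eq_zero fun j hj => ?_
  rw [mul_left_comm, functional_C_mul, mul_comm (gegenbauer α m),
    functional_X_pow_mul_gegenbauer_eq_zero hα hL j m (by rw [Finset.mem_range] at hj; omega),
    mul_zero]

/-- Otherwise `g` has degree below `m`, so orthogonality gives `L (q g²) = 0`, against positivity.
-/
theorem gegenbauer_ne_mul_of_nonneg (hα : -1 / 2 < α)
    (hL : ∀ F : ℝ[X], L ((1 - X ^ 2) * derivative F - C (2 * α + 1) * (X * F)) = 0)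
    (hpos : ∀ p : ℝ[X], p ≠ 0 → (∀ t ∈ Set.Icc (-1 : ℝ) 1, 0 ≤ p.eval t) → 0 < L p)
    (m : ℕ) (q g : ℝ[X]) (hq : 0 < q.natDegree)
    (hqpos : ∀ t ∈ Set.Icc (-1 : ℝ) 1, 0 ≤ q.eval t) : gegenbauer α m ≠ q * g := by
  intro h
  have h0 := gegenbauer_ne_zero hα m
  have hg : g ≠ 0 := by
    rintro rfl
    exact h0 (by rw [h, mul_zero])
  have hd : q.natDegree + g.natDegree = m := by
    rw [← natDegree_mul (ne_zero_of_natDegree_gt hq) hg, ← h, natDegree_gegenbauer hα]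
  refine (hpos (gegenbauer α m * g) (mul_ne_zero h0 hg) fun t ht => ?_).ne'
    (functional_gegenbauer_mul_eq_zero hα hL m g (by omega))
  rw [h, eval_mul, eval_mul, mul_assoc]
  exact mul_nonneg (hqpos t ht) (mul_self_nonneg _)

theorem gegenbauer_ne_mul_of_nonpos (hα : -1 / 2 < α)
    (hL : ∀ F : ℝ[X], L ((1 - X ^ 2) * derivative F - C (2 * α + 1) * (X * F)) = 0)
    (hpos : ∀ p : ℝ[X], p ≠ 0 → (∀ t ∈ Set.Icc (-1 : ℝ) 1, 0 ≤ p.eval t) → 0 < L p)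
    (m : ℕ) (q g : ℝ[X]) (hq : 0 < q.natDegree)
    (hqneg : ∀ t ∈ Set.Icc (-1 : ℝ) 1, q.eval t ≤ 0) : gegenbauer α m ≠ q * g := by
  rw [← neg_mul_neg]
  exact gegenbauer_ne_mul_of_nonneg hα hL hpos m (-q) (-g) (by rwa [natDegree_neg])
    fun t ht => by simpa using hqneg t ht

theorem eval_pos_or_neg_of_forall_eval_ne_zero (q : ℝ[X]) (h : ∀ t, q.eval t ≠ 0) :
    (∀ t, 0 < q.eval t) ∨ ∀ t, q.eval t < 0 := by
  by_contra! hc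
  obtain ⟨⟨a, ha⟩, b, hb⟩ := hc
  obtain ⟨c, hc⟩ := mem_range_of_exists_le_of_exists_ge q.continuous ⟨a, ha⟩ ⟨b, hb⟩
  exact h c hc

theorem splits_gegenbauer (hα : -1 / 2 < α)
    (hL : ∀ F : ℝ[X], L ((1 - X ^ 2) * derivative F - C (2 * α + 1) * (X * F)) = 0)
    (hpos : ∀ p : ℝ[X], p ≠ 0 → (∀ t ∈ Set.Icc (-1 : ℝ) 1, 0 ≤ p.eval t) → 0 < L p)
    (m : ℕ) : (gegenbauer α m).Splits := by
  obtain ⟨u, hu⟩ := UniqueFactorizationMonoid.factors_prod (gegenbauer_ne_zero hα m)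
  rw [← hu]
  refine (Splits.multisetProd fun q hq' => Splits.of_degree_eq_one ?_).mul u.isUnit.splits
  have hq := UniqueFactorizationMonoid.irreducible_of_factor q hq'
  obtain ⟨g, hg⟩ := UniqueFactorizationMonoid.dvd_of_mem_factors hq'
  by_contra hd
  -- A nonlinear irreducible factor has no real root, hence has constant sign.
  rcases eval_pos_or_neg_of_forall_eval_ne_zero q
    fun t ht => hd (degree_eq_one_of_irreducible_of_root hq ht) with h | h
  · exact gegenbauer_ne_mul_of_nonneg hα hL hpos m q g hq.natDegree_pos (fun t _ => (h t).le) hg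
  · exact gegenbauer_ne_mul_of_nonpos hα hL hpos m q g hq.natDegree_pos (fun t _ => (h t).le) hg

theorem mem_Ioo_of_isRoot_gegenbauer (hα : -1 / 2 < α)
    (hL : ∀ F : ℝ[X], L ((1 - X ^ 2) * derivative F - C (2 * α + 1) * (X * F)) = 0)
    (hpos : ∀ p : ℝ[X], p ≠ 0 → (∀ t ∈ Set.Icc (-1 : ℝ) 1, 0 ≤ p.eval t) → 0 < L p)
    (m : ℕ) (y : ℝ) (hy : (gegenbauer α m).IsRoot y) : y ∈ Set.Ioo (-1 : ℝ) 1 := by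
  obtain ⟨g, hg⟩ := dvd_iff_isRoot.2 hy
  refine ⟨lt_of_not_ge fun h => ?_, lt_of_not_ge fun h => ?_⟩
  · refine gegenbauer_ne_mul_of_nonneg hα hL hpos m _ g (by simp) (fun t ht => ?_) hg
    simpa using h.trans ht.1
  · refine gegenbauer_ne_mul_of_nonpos hα hL hpos m _ g (by simp) (fun t ht => ?_) hg
    simpa using ht.2.trans h

/-! ### Associated polynomials, the Casoratian and simplicity of the zeros. -/

theorem X_sub_C_mul_divByMonic (p : ℝ[X]) (y : ℝ) :
    (X - C y) * (p /ₘ (X - C y)) = p - C (p.eval y) := by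
  rw [X_sub_C_mul_divByMonic_eq_sub_modByMonic, modByMonic_X_sub_C_eq_C_eval]

theorem X_mul_divByMonic_X_sub_C (p : ℝ[X]) (y : ℝ) :
    (X * p) /ₘ (X - C y) = p + C y * (p /ₘ (X - C y)) := by
  apply mul_left_cancel₀ (X_sub_C_ne_zero y)
  rw [mul_add, mul_left_comm, X_sub_C_mul_divByMonic, X_sub_C_mul_divByMonic, eval_mul, eval_X,
    C_mul]
  ring

theorem C_mul_divByMonic_X_sub_C (c : ℝ) (p : ℝ[X]) (y : ℝ) :
    (C c * p) /ₘ (X - C y) = C c * (p /ₘ (X - C y)) := by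
  apply mul_left_cancel₀ (X_sub_C_ne_zero y)
  rw [mul_left_comm, X_sub_C_mul_divByMonic, X_sub_C_mul_divByMonic, eval_mul, eval_C, C_mul]
  ring

theorem sub_divByMonic_X_sub_C (p q : ℝ[X]) (y : ℝ) :
    (p - q) /ₘ (X - C y) = p /ₘ (X - C y) - q /ₘ (X - C y) := by
  apply mul_left_cancel₀ (X_sub_C_ne_zero y)
  rw [mul_sub, X_sub_C_mul_divByMonic, X_sub_C_mul_divByMonic, X_sub_C_mul_divByMonic, eval_sub,
    C_sub]
  ring

/-- Dividing `X * G_{m+1}` by `X - y` leaves an extra `G_{m+1}`, which `L` kills; so the associated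
polynomials obey the same recurrence. -/
theorem functional_divByMonic_recurrence (hα : -1 / 2 < α)
    (hL : ∀ F : ℝ[X], L ((1 - X ^ 2) * derivative F - C (2 * α + 1) * (X * F)) = 0)
    (m : ℕ) (y : ℝ) :
    ((m + 1 : ℝ) + 2 * α) * L (gegenbauer α (m + 2) /ₘ (X - C y)) =
      2 * ((m + 1 : ℝ) + α) * (y * L (gegenbauer α (m + 1) /ₘ (X - C y))) -
        (m + 1 : ℝ) * L (gegenbauer α m /ₘ (X - C y)) := by
  have h := congrArg (fun p => L (p /ₘ (X - C y))) (gegenbauer_recurrence hα m)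
  simpa only [sub_divByMonic_X_sub_C, mul_assoc (C _) X, C_mul_divByMonic_X_sub_C,
    X_mul_divByMonic_X_sub_C, L.map_sub, L.map_add, functional_C_mul,
    functional_gegenbauer_eq_zero hα hL m, zero_add] using h

/-- The Casorati determinant of the Gegenbauer polynomials and their associated polynomials
is a positive constant. -/
theorem exists_casoratian_eq (hα : -1 / 2 < α)
    (hL : ∀ F : ℝ[X], L ((1 - X ^ 2) * derivative F - C (2 * α + 1) * (X * F)) = 0)
    (h1 : 0 < L 1) (m : ℕ) : ∃ K : ℝ, 0 < K ∧ ∀ y : ℝ,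
      L (gegenbauer α (m + 1) /ₘ (X - C y)) * (gegenbauer α m).eval y -
        L (gegenbauer α m /ₘ (X - C y)) * (gegenbauer α (m + 1)).eval y = K := by
  induction m with
  | zero =>
    refine ⟨L 1, h1, fun y => ?_⟩
    have e : (X : ℝ[X]) /ₘ (X - C y) = 1 := by
      simpa [(divByMonic_eq_zero_iff (monic_X_sub_C y)).2 (by simp : degree (1 : ℝ[X]) < _)]
        using X_mul_divByMonic_X_sub_C 1 y
    have e' : (1 : ℝ[X]) /ₘ (X - C y) = 0 :=
      (divByMonic_eq_zero_iff (monic_X_sub_C y)).2 (by simp)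
    simp [gegenbauer, e, e']
  | succ m ih =>
    obtain ⟨K, hK, h⟩ := ih
    have hm : (0 : ℝ) ≤ m := m.cast_nonneg
    have hd : 0 < (m + 1 : ℝ) + 2 * α := by linarith
    -- The middle terms of the two recurrences cancel in the determinant, leaving the ratio of the
    -- outer coefficients.
    refine ⟨(m + 1) / ((m + 1 : ℝ) + 2 * α) * K, by positivity, fun y => ?_⟩
    have r := congrArg (eval y) (gegenbauer_recurrence hα m)
    simp only [eval_mul, eval_sub, eval_C, eval_X] at r
    have s := functional_divByMonic_recurrence hα hL m y
    rw [← h y, div_mul_eq_mul_div, eq_div_iff hd.ne']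
    linear_combination (eval y (gegenbauer α (m + 1))) * s -
      L (gegenbauer α (m + 1) /ₘ (X - C y)) * r

/-- At a double zero the structure relation makes the preceding polynomial vanish too, so the
Casoratian would be zero. -/
theorem eval_derivative_gegenbauer_ne_zero (hα : -1 / 2 < α)
    (hL : ∀ F : ℝ[X], L ((1 - X ^ 2) * derivative F - C (2 * α + 1) * (X * F)) = 0)
    (h1 : 0 < L 1) (m : ℕ) (y : ℝ) (hy : (gegenbauer α m).IsRoot y) :
    (derivative (gegenbauer α m)).eval y ≠ 0 := by
  obtain _ | m := m
  · simp [gegenbauer] at hy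
  intro h0
  obtain ⟨K, hK, h⟩ := exists_casoratian_eq hα hL h1 m
  have h := h y
  have d := congrArg (eval y) (one_sub_sq_mul_derivative_gegenbauer hα m)
  have : (m + 1 : ℝ) ≠ 0 := by positivity
  simp only [eval_mul, h0, eval_C, eval_sub, eval_X, hy.eq_zero, mul_zero, sub_zero,
    zero_eq_mul, this, false_or] at d
  rw [d, hy.eq_zero] at h
  linarith

theorem nodup_roots_gegenbauer (hα : -1 / 2 < α)
    (hL : ∀ F : ℝ[X], L ((1 - X ^ 2) * derivative F - C (2 * α + 1) * (X * F)) = 0)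
    (h1 : 0 < L 1) (m : ℕ) : (gegenbauer α m).roots.Nodup := by
  rw [Multiset.nodup_iff_count_le_one]
  intro y
  rw [count_roots]
  by_contra! h
  obtain ⟨hd, hy⟩ := (one_lt_rootMultiplicity_iff_isRoot (gegenbauer_ne_zero hα m)).1 h
  exact eval_derivative_gegenbauer_ne_zero hα hL h1 m y hd hy

theorem card_roots_toFinset_gegenbauer (hα : -1 / 2 < α)
    (hL : ∀ F : ℝ[X], L ((1 - X ^ 2) * derivative F - C (2 * α + 1) * (X * F)) = 0)
    (hpos : ∀ p : ℝ[X], p ≠ 0 → (∀ t ∈ Set.Icc (-1 : ℝ) 1, 0 ≤ p.eval t) → 0 < L p)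
    (m : ℕ) : (gegenbauer α m).roots.toFinset.card = m := by
  have h1 : 0 < L 1 := hpos 1 one_ne_zero (by simp)
  rw [Multiset.toFinset_card_of_nodup (nodup_roots_gegenbauer hα hL h1 m),
    splits_iff_card_roots.1 (splits_gegenbauer hα hL hpos m), natDegree_gegenbauer hα]

end Functional

/-! ### The Gegenbauer integral satisfies Pearson's identity and positivity. -/

theorem gegenbauerWeight_pos {α x : ℝ} (hx : x ∈ Set.Ioo (-1 : ℝ) 1) :
    0 < gegenbauerWeight α x :=
  Real.rpow_pos_of_pos (by nlinarith [hx.1, hx.2]) _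

theorem intervalIntegrable_gegenbauerWeight {α : ℝ} (hα : -1 / 2 < α) :
    IntervalIntegrable (gegenbauerWeight α) MeasureTheory.volume (-1) 1 := by
  have h01 : IntervalIntegrable (gegenbauerWeight α) MeasureTheory.volume 0 1 := by
    have h : IntervalIntegrable (fun x : ℝ => (1 - x) ^ (α - 1 / 2)) MeasureTheory.volume 0 1 := by
      have := (intervalIntegral.intervalIntegrable_rpow' (a := 1) (b := 0)
        (by linarith : -1 < α - 1 / 2)).comp_sub_left 1
      simpa using this
    have hc : ContinuousOn (fun x : ℝ => (1 + x) ^ (α - 1 / 2)) (Set.uIcc 0 1) := by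
      refine ContinuousOn.rpow_const (by fun_prop) fun x hx => Or.inl ?_
      rw [Set.uIcc_of_le zero_le_one] at hx
      linarith [hx.1]
    refine (h.mul_continuousOn hc).congr fun x hx => ?_
    rw [Set.uIoc_of_le zero_le_one] at hx
    rw [gegenbauerWeight, ← Real.mul_rpow (by linarith [hx.2]) (by linarith [hx.1])]
    congr 1
    ring
  refine IntervalIntegrable.trans (b := 0) ?_ h01
  have := (h01.comp_sub_left 0).symm
  simp only [gegenbauerWeight, zero_sub, neg_zero, neg_sq] at this
  exact this

theorem intervalIntegrable_eval_mul_gegenbauerWeight {α : ℝ} (hα : -1 / 2 < α) (p : ℝ[X]) :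
    IntervalIntegrable (fun t => p.eval t * gegenbauerWeight α t) MeasureTheory.volume (-1) 1 :=
  (intervalIntegrable_gegenbauerWeight hα).continuousOn_mul p.continuousOn

/-- Integration of polynomials on `[-1, 1]` against the Gegenbauer weight. -/
noncomputable def gegenbauerFunctional (α : ℝ) (hα : -1 / 2 < α) : ℝ[X] →ₗ[ℝ] ℝ where
  toFun p := ∫ t in (-1 : ℝ)..1, p.eval t * gegenbauerWeight α t
  map_add' p q := by
    simp only [eval_add, add_mul]
    exact intervalIntegral.integral_add (intervalIntegrable_eval_mul_gegenbauerWeight hα p)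
      (intervalIntegrable_eval_mul_gegenbauerWeight hα q)
  map_smul' c p := by
    simp only [eval_smul, smul_eq_mul, mul_assoc, RingHom.id_apply,
      intervalIntegral.integral_const_mul]

theorem gegenbauerFunctional_apply {α : ℝ} (hα : -1 / 2 < α) (p : ℝ[X]) :
    gegenbauerFunctional α hα p = ∫ t in (-1 : ℝ)..1, p.eval t * gegenbauerWeight α t :=
  rfl

/-- The integrand is the derivative of `(1 - t²)^(α + 1/2) F(t)`, which vanishes at `±1` since `α +
1/2 > 0`. -/
theorem gegenbauerFunctional_pearson {α : ℝ} (hα : -1 / 2 < α) (F : ℝ[X]) :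
    gegenbauerFunctional α hα ((1 - X ^ 2) * derivative F - C (2 * α + 1) * (X * F)) = 0 := by
  rw [gegenbauerFunctional_apply, intervalIntegral.integral_eq_sub_of_hasDerivAt_of_le
    (f := fun t => (1 - t ^ 2) ^ (α + 1 / 2) * F.eval t) (by norm_num) ?_ ?_
    (intervalIntegrable_eval_mul_gegenbauerWeight hα _)]
  · have : α + 1 / 2 ≠ 0 := by linarith
    simp only [neg_sq, one_pow, sub_self, Real.zero_rpow this, zero_mul]
  · refine ContinuousOn.mul (ContinuousOn.rpow_const (by fun_prop) fun x _ => Or.inr ?_)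
      F.continuousOn
    linarith
  · intro t ht
    have h0 : 0 < 1 - t ^ 2 := by nlinarith [ht.1, ht.2]
    have hd : HasDerivAt (fun t : ℝ => 1 - t ^ 2) (-(2 * t)) t := by
      simpa using (hasDerivAt_pow 2 t).const_sub 1
    refine ((hd.rpow_const (p := α + 1 / 2) (Or.inl h0.ne')).mul (F.hasDerivAt t)).congr_deriv ?_
    have e : (1 - t ^ 2) ^ (α + 1 / 2) = (1 - t ^ 2) * (1 - t ^ 2) ^ (α - 1 / 2) := by
      rw [← Real.rpow_one_add' h0.le (by linarith)]
      congr 1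
      ring
    have e' : α + 1 / 2 - 1 = α - 1 / 2 := by ring
    simp only [e, e', gegenbauerWeight, eval_sub, eval_mul, eval_one, eval_pow, eval_X, eval_C]
    ring

theorem gegenbauerFunctional_pos {α : ℝ} (hα : -1 / 2 < α) (p : ℝ[X]) (hp : p ≠ 0)
    (h : ∀ t ∈ Set.Icc (-1 : ℝ) 1, 0 ≤ p.eval t) : 0 < gegenbauerFunctional α hα p := by
  have hi := intervalIntegrable_eval_mul_gegenbauerWeight hα p
  have hle : (-1 : ℝ) ≤ 1 := by norm_num
  rw [gegenbauerFunctional_apply, intervalIntegral.integral_of_le hle,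
    MeasureTheory.integral_Ioc_eq_integral_Ioo,
    MeasureTheory.setIntegral_pos_iff_support_of_nonneg_ae]
  · have hs : Set.Ioo (-1 : ℝ) 1 \ (p.roots.toFinset : Set ℝ) ⊆
        (Function.support fun t => p.eval t * gegenbauerWeight α t) ∩ Set.Ioo (-1) 1 := by
      rintro t ⟨ht, hr⟩
      refine ⟨mul_ne_zero (fun h0 => hr ?_) (gegenbauerWeight_pos ht).ne', ht⟩
      simpa [hp] using h0
    refine lt_of_lt_of_le ?_ (MeasureTheory.measure_mono hs)
    rw [MeasureTheory.measure_sdiff_null (p.roots.toFinset.finite_toSet.measure_zero _),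
      Real.volume_Ioo]
    norm_num
  · filter_upwards [MeasureTheory.ae_restrict_mem measurableSet_Ioo] with t ht
    exact mul_nonneg (h t (Set.Ioo_subset_Icc_self ht)) (gegenbauerWeight_pos ht).le
  · exact ((intervalIntegrable_iff_integrableOn_Ioc_of_le hle).1 hi).mono_set
      Set.Ioo_subset_Ioc_self

/-! ### Signs of the node products and the barycentric formula. -/

section BarycentricWeights

variable {n : ℕ} {x : Fin (n + 1) → ℝ}

/-- Exactly the `i` factors with `j < i` are negative. -/
theorem neg_one_pow_mul_prod_sub_pos_of_strictAnti (hx : StrictAnti x) (i : Fin (n + 1)) :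
    0 < (-1) ^ (i : ℕ) * ∏ j ∈ Finset.univ.erase i, (x i - x j) := by
  have e : (Finset.univ.erase i : Finset (Fin (n + 1))) =
      (Finset.Iio i).disjUnion (Finset.Ioi i)
        (Finset.disjoint_left.2 fun j h h' => by
          rw [Finset.mem_Iio] at h; rw [Finset.mem_Ioi] at h'; exact h.asymm h') := by
    ext j
    simp
  have h : (-1 : ℝ) ^ (i : ℕ) * ∏ j ∈ Finset.Iio i, (x i - x j) =
      ∏ j ∈ Finset.Iio i, (x j - x i) := by
    rw [← Fin.card_Iio i, ← Finset.prod_const, ← Finset.prod_mul_distrib]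
    exact Finset.prod_congr rfl fun j _ => by ring
  rw [e, Finset.prod_disjUnion, ← mul_assoc, h]
  refine mul_pos (Finset.prod_pos fun j hj => sub_pos.2 (hx (Finset.mem_Iio.1 hj)))
    (Finset.prod_pos fun j hj => sub_pos.2 (hx (Finset.mem_Ioi.1 hj)))

theorem neg_one_pow_mul_prod_sub_pos_of_strictMono (hx : StrictMono x) (i : Fin (n + 1)) :
    0 < (-1) ^ n * (-1) ^ (i : ℕ) * ∏ j ∈ Finset.univ.erase i, (x i - x j) := by
  have h := neg_one_pow_mul_prod_sub_pos_of_strictAnti (x := fun j => -x j)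
    (fun a b hab => neg_lt_neg (hx hab)) i
  have hc : (Finset.univ.erase i : Finset (Fin (n + 1))).card = n := by simp
  have e : ∏ j ∈ Finset.univ.erase i, (-x i - -x j) =
      (-1) ^ n * ∏ j ∈ Finset.univ.erase i, (x i - x j) := by
    have hn : (-1 : ℝ) ^ n = ∏ _j ∈ Finset.univ.erase i, (-1) := by rw [Finset.prod_const, hc]
    rw [hn, ← Finset.prod_mul_distrib]
    exact Finset.prod_congr rfl fun j _ => by ring
  rw [e] at h
  linarith

theorem barycentricWeight_eq_nodalWeight (i : Fin (n + 1)) :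
    barycentricWeight x i = Lagrange.nodalWeight Finset.univ x i := by
  rw [barycentricWeight, Lagrange.nodalWeight, Finset.prod_inv_distrib, one_div]

theorem barycentricBasis_eq_eval_basis (hx : Function.Injective x) {ξ : Fin (n + 1) → ℝ} {c : ℝ}
    (hc : c ≠ 0) (h : ∀ i, barycentricWeight x i = c * ξ i) (i : Fin (n + 1)) {t : ℝ}
    (ht : ∀ j, t ≠ x j) :
    barycentricBasis x ξ i t = (Lagrange.basis Finset.univ x i).eval t := by
  have hξ : ∀ j, ξ j / (t - x j) =
      c⁻¹ * (Lagrange.nodalWeight Finset.univ x j * (t - x j)⁻¹) := fun j => by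
    rw [← barycentricWeight_eq_nodalWeight, h, mul_assoc, inv_mul_cancel_left₀ hc,
      div_eq_mul_inv]
  -- This is the partition of unity by the Lagrange basis, evaluated at `t`.
  have hsum : eval t (Lagrange.nodal Finset.univ x) *
      ∑ j, Lagrange.nodalWeight Finset.univ x j * (t - x j)⁻¹ = 1 := by
    have h1 := congrArg (eval t)
      (Lagrange.sum_basis (v := x) (s := Finset.univ) hx.injOn Finset.univ_nonempty)
    rw [eval_finsetSum, eval_one] at h1
    rw [← h1, Finset.mul_sum]
    exact Finset.sum_congr rfl fun j hj => (Lagrange.eval_basis_not_at_node hj (ht j)).symm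
  rw [barycentricBasis, Lagrange.eval_basis_not_at_node (Finset.mem_univ i) (ht i)]
  simp only [hξ]
  rw [← Finset.mul_sum, mul_div_mul_left _ _ (inv_ne_zero hc),
    div_eq_iff (right_ne_zero_of_mul_eq_one hsum)]
  linear_combination
    -(Lagrange.nodalWeight Finset.univ x i * (t - x i)⁻¹) * hsum

end BarycentricWeights

/-! ### Gauss nodes, Christoffel numbers and the conclusion. -/

section GaussNodes

variable {α : ℝ} {n : ℕ}

theorem card_roots_toFinset_gegenbauer_succ (hα : -1 / 2 < α) (n : ℕ) :
    (gegenbauer α (n + 1)).roots.toFinset.card = n + 1 :=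
  card_roots_toFinset_gegenbauer hα (gegenbauerFunctional_pearson hα)
    (gegenbauerFunctional_pos hα) (n + 1)

theorem gaussNode_eq_orderEmbOfFin (hα : -1 / 2 < α) (n : ℕ) :
    gaussNode α n = (gegenbauer α (n + 1)).roots.toFinset.orderEmbOfFin
      (card_roots_toFinset_gegenbauer_succ hα n) := by
  funext i
  rw [Finset.orderEmbOfFin_apply, gaussNode, List.getD_eq_getElem]
  rfl

theorem strictMono_gaussNode (hα : -1 / 2 < α) (n : ℕ) : StrictMono (gaussNode α n) := by
  rw [gaussNode_eq_orderEmbOfFin hα]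
  exact OrderEmbedding.strictMono _

theorem range_gaussNode (hα : -1 / 2 < α) (n : ℕ) :
    Set.range (gaussNode α n) = {y : ℝ | (gegenbauer α (n + 1)).IsRoot y} := by
  rw [gaussNode_eq_orderEmbOfFin hα, Finset.range_orderEmbOfFin]
  ext y
  simp [gegenbauer_ne_zero hα]

theorem gegenbauer_eq_C_mul_nodal (hα : -1 / 2 < α) {x : Fin (n + 1) → ℝ}
    (hinj : Function.Injective x)
    (hrange : Set.range x = {y : ℝ | (gegenbauer α (n + 1)).IsRoot y}) :
    gegenbauer α (n + 1) =
      C (gegenbauer α (n + 1)).leadingCoeff * Lagrange.nodal Finset.univ x := by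
  have hs := splits_gegenbauer hα (gegenbauerFunctional_pearson hα)
    (gegenbauerFunctional_pos hα) (n + 1)
  have hn := nodup_roots_gegenbauer hα (gegenbauerFunctional_pearson hα)
    (gegenbauerFunctional_pos hα 1 one_ne_zero (by simp)) (n + 1)
  have hr : (gegenbauer α (n + 1)).roots = Finset.univ.val.map x := by
    refine (Multiset.Nodup.ext hn (Finset.univ.nodup.map hinj)).2 fun y => ?_
    rw [mem_roots (gegenbauer_ne_zero hα _), Multiset.mem_map]
    simp only [Finset.mem_val, Finset.mem_univ, true_and]
    exact (Set.ext_iff.1 hrange y).symm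
  conv_lhs => rw [hs.eq_prod_roots, hr]
  rw [Multiset.map_map, Lagrange.nodal]
  rfl

theorem exists_christoffelNumber_mul_eq (hα : -1 / 2 < α) {x : Fin (n + 1) → ℝ}
    (hinj : Function.Injective x)
    (hrange : Set.range x = {y : ℝ | (gegenbauer α (n + 1)).IsRoot y}) :
    ∃ K : ℝ, 0 < K ∧ ∀ i, (1 - x i ^ 2) * christoffelNumber α x i *
      (∏ j ∈ Finset.univ.erase i, (x i - x j)) ^ 2 = K := by
  obtain ⟨K, hK, hcas⟩ := exists_casoratian_eq hα (gegenbauerFunctional_pearson hα)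
    (gegenbauerFunctional_pos hα 1 one_ne_zero (by simp)) n
  set a := (gegenbauer α (n + 1)).leadingCoeff with ha
  have ha0 : a ≠ 0 := leadingCoeff_ne_zero.2 (gegenbauer_ne_zero hα _)
  have hP := gegenbauer_eq_C_mul_nodal hα hinj hrange
  rw [← ha] at hP
  refine ⟨(n + 1) * K / a ^ 2, by positivity, fun i => ?_⟩
  have hroot : (gegenbauer α (n + 1)).eval (x i) = 0 := by
    have : x i ∈ {y : ℝ | (gegenbauer α (n + 1)).IsRoot y} := hrange ▸ Set.mem_range_self i
    exact this
  have h := hcas (x i)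
  rw [hroot, mul_zero, sub_zero] at h
  set D := ∏ j ∈ Finset.univ.erase i, (x i - x j) with hD
  have hD0 : D ≠ 0 := Finset.prod_ne_zero_iff.2 fun j hj =>
    sub_ne_zero.2 fun h => (Finset.ne_of_mem_erase hj) (hinj h).symm
  have hbasis : C D * Lagrange.basis Finset.univ x i = Lagrange.nodal (Finset.univ.erase i) x := by
    rw [Lagrange.basis_eq_prod_sub_inv_mul_nodal_div (Finset.mem_univ i),
      ← Lagrange.nodal_erase_eq_nodal_div (Finset.mem_univ i), Lagrange.nodalWeight,
      Finset.prod_inv_distrib, ← hD, ← mul_assoc, ← C_mul, mul_inv_cancel₀ hD0, C_1, one_mul]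
  have hdiv : gegenbauer α (n + 1) /ₘ (X - C (x i)) =
      C (a * D) * Lagrange.basis Finset.univ x i := by
    rw [hP, C_mul_divByMonic_X_sub_C, Lagrange.nodal_eq_mul_nodal_erase (Finset.mem_univ i),
      mul_divByMonic_cancel_left _ (monic_X_sub_C _), ← hbasis, C_mul, mul_assoc]
  have hder : (derivative (gegenbauer α (n + 1))).eval (x i) = a * D := by
    rw [hP, derivative_C_mul, eval_mul, eval_C,
      Lagrange.eval_nodal_derivative_eval_node_eq (Finset.mem_univ i), Lagrange.eval_nodal]
  have hrel := congrArg (eval (x i)) (one_sub_sq_mul_derivative_gegenbauer hα n)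
  simp only [eval_mul, eval_sub, eval_one, eval_pow, eval_X, eval_C, hder, hroot, mul_zero,
    sub_zero] at hrel
  rw [hdiv, functional_C_mul, gegenbauerFunctional_apply] at h
  change a * D * christoffelNumber α x i * _ = K at h
  rw [eq_div_iff (pow_ne_zero 2 ha0)]
  linear_combination (christoffelNumber α x i * a * D) * hrel + (n + 1 : ℝ) * h

theorem trigWeight_eq {x : Fin (n + 1) → ℝ} {i : Fin (n + 1)} (hx : 0 ≤ 1 - x i ^ 2) :
    trigWeight α x i = (-1) ^ (i : ℕ) * √((1 - x i ^ 2) * christoffelNumber α x i) := by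
  rw [trigWeight, Real.sin_arccos, mul_assoc, Real.sqrt_mul hx]

theorem exists_barycentricWeight_eq_mul_trigWeight {x : Fin (n + 1) → ℝ}
    (hx : ∀ i, 0 ≤ 1 - x i ^ 2) {K : ℝ} (hK : 0 < K)
    (h : ∀ i, (1 - x i ^ 2) * christoffelNumber α x i *
      (∏ j ∈ Finset.univ.erase i, (x i - x j)) ^ 2 = K) {ε : ℝ} (hε : |ε| = 1)
    (hsign : ∀ i : Fin (n + 1),
      0 < ε * (-1) ^ (i : ℕ) * ∏ j ∈ Finset.univ.erase i, (x i - x j)) :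
    ∃ c : ℝ, c ≠ 0 ∧ ∀ i, barycentricWeight x i = c * trigWeight α x i := by
  have hε0 : ε ≠ 0 := by
    rintro rfl
    simp at hε
  have hε2 : ε * ε = 1 := by rw [← abs_mul_abs_self, hε, one_mul]
  have hs : 0 < √K := Real.sqrt_pos.2 hK
  refine ⟨ε / √K, div_ne_zero hε0 hs.ne', fun i => ?_⟩
  rw [trigWeight_eq (hx i), barycentricWeight]
  have hi := hsign i
  have hKi := h i
  set D := ∏ j ∈ Finset.univ.erase i, (x i - x j)
  have hD : D ≠ 0 := right_ne_zero_of_mul hi.ne'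
  have habs : |D| = ε * (-1) ^ (i : ℕ) * D := by
    rw [← abs_of_pos hi, abs_mul, abs_mul, hε, abs_pow, abs_neg, abs_one, one_pow, one_mul,
      one_mul]
  -- The root splits because `D ^ 2` is nonnegative; no sign of the Christoffel number is needed.
  have hsq : √K = √((1 - x i ^ 2) * christoffelNumber α x i) * |D| := by
    rw [← hKi, Real.sqrt_mul' _ (sq_nonneg D), Real.sqrt_sq_eq_abs]
  rw [habs] at hsq
  rw [div_mul_eq_mul_div, div_eq_div_iff hD hs.ne']
  linear_combination hsq

end GaussNodes

theorem mainTheorem3 (α : ℝ) (hα : -1 / 2 < α) (n : ℕ) (x : Fin (n + 1) → ℝ)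
    -- the Gegenbauer-Gauss nodes, listed in increasing or in decreasing order
    (hx : x = gaussNode α n ∨ x = gaussNode α n ∘ Fin.rev) :
    -- the nodes are `n + 1` distinct points and are exactly the zeros of `G_{n+1}`
    (Function.Injective x ∧ Set.range x = {y : ℝ | (gegenbauer α (n + 1)).IsRoot y}) ∧
    -- the barycentric weights are the trigonometric weights up to a common nonzero factor
    (∃ c : ℝ, c ≠ 0 ∧ ∀ i, barycentricWeight x i =
      c * trigWeight α x i) ∧
    -- hence they may serve as weights in the barycentric formula
    (∀ i, ∀ t : ℝ, (∀ j, t ≠ x j) →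
      barycentricBasis x (trigWeight α x) i t =
        (Lagrange.basis Finset.univ x i).eval t) ∧
    -- and they coincide with the algebraic form of the weights
    (∀ i, trigWeight α x i =
      (-1) ^ (i : ℕ) * √((1 - x i ^ 2) * christoffelNumber α x i)) := by
  have hinj : Function.Injective x := by
    rcases hx with rfl | rfl
    · exact (strictMono_gaussNode hα n).injective
    · exact (strictMono_gaussNode hα n).injective.comp Fin.rev_injective
  have hrange : Set.range x = {y : ℝ | (gegenbauer α (n + 1)).IsRoot y} := by
    rcases hx with rfl | rfl
    · exact range_gaussNode hα n
    · rw [Fin.rev_surjective.range_comp, range_gaussNode hα n]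
  have hsign : ∃ ε : ℝ, |ε| = 1 ∧ ∀ i : Fin (n + 1),
      0 < ε * (-1) ^ (i : ℕ) * ∏ j ∈ Finset.univ.erase i, (x i - x j) := by
    rcases hx with rfl | rfl
    · exact ⟨(-1) ^ n, by simp,
        neg_one_pow_mul_prod_sub_pos_of_strictMono (strictMono_gaussNode hα n)⟩
    · refine ⟨1, abs_one, fun i => ?_⟩
      rw [one_mul]
      exact neg_one_pow_mul_prod_sub_pos_of_strictAnti
        ((strictMono_gaussNode hα n).comp_strictAnti Fin.rev_strictAnti) i
  have hmem : ∀ i, 0 ≤ 1 - x i ^ 2 := fun i => by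
    have hi : x i ∈ {y : ℝ | (gegenbauer α (n + 1)).IsRoot y} := hrange ▸ Set.mem_range_self i
    obtain ⟨h₁, h₂⟩ := mem_Ioo_of_isRoot_gegenbauer hα (gegenbauerFunctional_pearson hα)
      (gegenbauerFunctional_pos hα) (n + 1) (x i) hi
    nlinarith
  obtain ⟨ε, hε, hsign⟩ := hsign
  obtain ⟨K, hK, h⟩ := exists_christoffelNumber_mul_eq hα hinj hrange
  obtain ⟨c, hc, hw⟩ := exists_barycentricWeight_eq_mul_trigWeight hmem hK h hε hsign
  exact ⟨⟨hinj, hrange⟩, ⟨c, hc, hw⟩,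
    fun i t ht => barycentricBasis_eq_eval_basis hinj hc hw i ht,
    fun i => trigWeight_eq (hmem i)⟩
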